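/- Let $|+\rangle=(|0\rangle+|1\rangle)/\sqrt2$ and let $\mathcal S_U=\{|\psi_1\rangle,|\psi_2\rangle,|\psi_3\rangle\}$ be the set of bipartite product states in $\mathbb C^2_A\otimes\mathbb C^2_B$ given by $|\psi_1\rangle=|0\rangle_A|0\rangle_B$, $|\psi_2\rangle=|0\rangle_A|+\rangle_B$, $|\psi_3\rangle=|+\rangle_A|0\rangle_B$. A finite family of states $(\rho_j)_{j\in J}$ is called antidistinguishable if there is a POVM $(\Pi_j)_{j\in J}$ with $\operatorname{Tr}(\rho_j\Pi_j)=0$ and $\sum_{i\in J}\operatorname{Tr}(\rho_i\Pi_j)>0$ for every $j\in J$. In the $(2,1)$-antimarking task for $\mathcal S_U$, one of the six states $|\psi_{ij}\rangle=|\psi_i\rangle_{A_1B_1}\otimes|\psi_j\rangle_{A_2B_2}$ with $i\ne j$ is supplied, and a measurement has to announce a pair $(x,y)$, $x\neq y$, that is never equal to the supplied pair $(i,j)$; that is, it is a POVM $(\Pi_{xy})_{x\ne y}$ with $\langle\psi_{xy}|\Pi_{xy}|\psi_{xy}\rangle=0$ for all $x\neq y$. Then the following hold. 1. $\mathcal S_U$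 is not antidistinguishable, even by global measurements on $AB$. 2. The family of the six states $|\psi_{ij}\rangle$, $i\neq j$, is antidistinguishable by a global measurement; in particular, $\mathcal S_U$ is globally $(2,1)$-antimarkable. 3. $\mathcal S_U$ is not $(2,1)$-antimarkable by LOCC between Alice, who holds $A_1A_2$, and Bob, who holds $B_1B_2$: no POVM $(\Pi_{xy})_{x\neq y}$ as above is implemented by an LOCC protocol with finitely many rounds (each round being a local quantum instrument of one party, whose outcome is broadcast), and none is a limit of POVMs that are implemented by such protocols. -/

import Mathlib

open Matrix
open scoped Kronecker ComplexOrder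

noncomputable section

namespace Antimarking

/-! ### States and measurements -/

/-- The density matrix `|ψ⟩⟨ψ|` of a pure state `ψ`. -/
def ketbra {ι : Type*} (ψ : ι → ℂ) : Matrix ι ι ℂ :=
  vecMulVec ψ (star ψ)

/-- The Born probability `Tr (ρ E)`. -/
def bornProb {ι : Type*} [Fintype ι] (ρ E : Matrix ι ι ℂ) : ℝ :=
  (ρ * E).trace.re

/-- `M` is a POVM with outcomes in the finite type `O`. -/
def IsPOVM {O ι : Type*} [Fintype O] [Fintype ι] [DecidableEq ι]
    (M : O → Matrix ι ι ℂ) : Prop :=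
  (∀ o, (M o).PosSemidef) ∧ ∑ o, M o = 1

/-- (Strong) antidistinguishability: some POVM has, for every `j`, an outcome `j` that never
occurs on the state `ρ j`, and each of these outcomes occurs with positive probability on some
state of the family. -/
def Antidistinguishable {I ι : Type*} [Fintype I] [Fintype ι] [DecidableEq ι]
    (ρ : I → Matrix ι ι ℂ) : Prop :=
  ∃ M : I → Matrix ι ι ℂ, IsPOVM M ∧
    (∀ j, bornProb (ρ j) (M j) = 0) ∧
    (∀ j, 0 < ∑ i, bornProb (ρ i) (M j))

/-! ### Finite-round LOCC -/

/-- A quantum instrument on a system with basis `A`: finitely many classical outcomes `k`, each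
with a completely positive map, given by Kraus operators `K k l`, into a system of dimension
`dim k`; the sum of all these maps preserves the trace. The output dimension is arbitrary, so
that ancillas may be attached and subsystems discarded. -/
structure Instrument (A : Type) [Fintype A] [DecidableEq A] where
  outcomes : ℕ
  dim : Fin outcomes → ℕ
  krausNum : Fin outcomes → ℕ
  K : (k : Fin outcomes) → Fin (krausNum k) → Matrix (Fin (dim k)) A ℂ
  complete : ∑ k, ∑ l, (K k l)ᴴ * K k l = 1

/-- A finite-round two-party LOCC protocol on systems with bases `A` (Alice) and `B` (Bob) that
announces a final answer in `O`. At each step either the answer is announced, or one of the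
parties applies a local instrument and broadcasts its classical outcome `k`; the continuation may
depend on `k`. -/
inductive Protocol (O : Type) : (A B : Type) → [Fintype A] → [DecidableEq A] →
    [Fintype B] → [DecidableEq B] → Type 1
  | announce {A B : Type} [Fintype A] [DecidableEq A] [Fintype B] [DecidableEq B]
      (o : O) : Protocol O A B
  | alice {A B : Type} [Fintype A] [DecidableEq A] [Fintype B] [DecidableEq B]
      (J : Instrument A) (next : (k : Fin J.outcomes) → Protocol O (Fin (J.dim k)) B) :
      Protocol O A B
  | bob {A B : Type} [Fintype A] [DecidableEq A] [Fintype B] [DecidableEq B]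
      (J : Instrument B) (next : (k : Fin J.outcomes) → Protocol O A (Fin (J.dim k))) :
      Protocol O A B

/-- The POVM on the joint system that an LOCC protocol implements: `P.povm o` is the effect whose
Born probability is the probability that `P` announces `o`. -/
def Protocol.povm {O : Type} [DecidableEq O] {A B : Type} [iA : Fintype A] [dA : DecidableEq A]
    [iB : Fintype B] [dB : DecidableEq B] (P : Protocol O A B) (o : O) :
    Matrix (A × B) (A × B) ℂ :=
  match A, B, iA, dA, iB, dB, P with
  | _, _, _, _, _, _, @Protocol.announce _ _ _ _ _ _ _ o' => if o = o' then 1 else 0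
  | _, B, _, _, _, _, @Protocol.alice _ _ _ _ _ _ _ J next =>
      ∑ k, ∑ l, (J.K k l ⊗ₖ (1 : Matrix B B ℂ))ᴴ * (next k).povm o *
        (J.K k l ⊗ₖ (1 : Matrix B B ℂ))
  | A, _, _, _, _, _, @Protocol.bob _ _ _ _ _ _ _ J next =>
      ∑ k, ∑ l, ((1 : Matrix A A ℂ) ⊗ₖ J.K k l)ᴴ * (next k).povm o *
        ((1 : Matrix A A ℂ) ⊗ₖ J.K k l)

/-! ### Antimarking -/

section Antimarking

variable {I A B : Type} [Fintype I] [DecidableEq I]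
  [Fintype A] [DecidableEq A] [Fintype B] [DecidableEq B]

/-- The state `ψ_{s 1} ⊗ ⋯ ⊗ ψ_{s n}` of a sequence `s` without repetition, arranged along the
bipartition `A₁ ⋯ Aₙ | B₁ ⋯ Bₙ`. -/
def seqState (ψ : I → A × B → ℂ) {n : ℕ} (s : Fin n ↪ I) : (Fin n → A) × (Fin n → B) → ℂ :=
  fun x => ∏ t, ψ (s t) (x.1 t, x.2 t)

/-- The possible answers in the `(n, m)`-antimarking task: sets of exactly `m` sequences of length
`n` without repetition. -/
abbrev Answer (I : Type) (n m : ℕ) : Type :=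
  {T : Finset (Fin n ↪ I) // T.card = m}

/-- A measurement with outcomes `Answer I n m` eliminates perfectly: the supplied sequence is
never among the `m` announced ones. -/
def Eliminates (ψ : I → A × B → ℂ) (n m : ℕ)
    (M : Answer I n m → Matrix ((Fin n → A) × (Fin n → B)) ((Fin n → A) × (Fin n → B)) ℂ) :
    Prop :=
  ∀ T : Answer I n m, ∀ s ∈ T.1, bornProb (ketbra (seqState ψ s)) (M T) = 0

/-- `(n, m)`-antimarkability by a global measurement. -/
def GloballyAntimarkable (ψ : I → A × B → ℂ) (n m : ℕ) : Prop :=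
  ∃ M : Answer I n m → Matrix ((Fin n → A) × (Fin n → B)) ((Fin n → A) × (Fin n → B)) ℂ,
    IsPOVM M ∧ Eliminates ψ n m M

/-- `(n, m)`-antimarkability by an LOCC protocol with finitely many rounds. -/
def LOCCAntimarkable (ψ : I → A × B → ℂ) (n m : ℕ) : Prop :=
  ∃ P : Protocol (Answer I n m) (Fin n → A) (Fin n → B), Eliminates ψ n m P.povm

/-- `(n, m)`-antimarkability by a limit of measurements that finite-round LOCC protocols
implement. Measurements by LOCC with infinitely many rounds are such limits. -/
def AsymptoticallyLOCCAntimarkable (ψ : I → A × B → ℂ) (n m : ℕ) : Prop :=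
  ∃ M ∈ closure (Set.range
      (Protocol.povm (O := Answer I n m) (A := Fin n → A) (B := Fin n → B))),
    Eliminates ψ n m M

end Antimarking

/-! ### The set `{|00⟩, |0+⟩, |+0⟩}` -/

/-- The qubit state `|0⟩`. -/
def ket0 : Fin 2 → ℂ := ![1, 0]

/-- The qubit state `|+⟩ = (|0⟩ + |1⟩) / √2`. -/
def ketPlus : Fin 2 → ℂ := ![((1 / √2 : ℝ) : ℂ), ((1 / √2 : ℝ) : ℂ)]

/-- The product state `|α⟩_A |β⟩_B`. -/
def productState {A B : Type} (α : A → ℂ) (β : B → ℂ) : A × B → ℂ :=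
  fun x => α x.1 * β x.2

/-- The bipartite product states `|0⟩|0⟩`, `|0⟩|+⟩`, `|+⟩|0⟩`. -/
def SU : Fin 3 → Fin 2 × Fin 2 → ℂ :=
  ![productState ket0 ket0, productState ket0 ketPlus, productState ketPlus ket0]

end Antimarking

end

open Matrix
open scoped Kronecker ComplexOrder

noncomputable section

namespace Antimarking

/-! ### Traces and Born probabilities -/

/-! Both impossibility claims are instances of semidefinite duality: a Hermitian `Y` below every
state of a family with `Tr Y > 0` forces the total error of any measurement to be at least `Tr Y`.
One explicit matrix, `pairWitness`, serves for both. Alice's local states are `|0⟩, |0⟩, |+⟩` and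
Bob's `|0⟩, |+⟩, |0⟩`, so for a pair of distinct indices each party's two qubits are in `|00⟩`,
`|0+⟩` or `|+0⟩`, never in `|++⟩`. Each party thus faces the very family `SU` that is not
antidistinguishable.

Local witnesses `Y` and `Z` combine along an LOCC protocol (`Protocol.mul_trace_le_sum_bornProb`): a
local completely positive map preserves the order `Y ≤ R o`, and an instrument preserves the total
trace. The resulting error bound `Tr Y * Tr Z` is the same for all protocols, hence survives limits.

A global measurement escapes the bound. It is built from the four vectors `elimVec t r`: each is
orthogonal to one sequence state involving `ψ_3`, and for fixed `t` the two span a plane containing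
one of the two states without `ψ_3`. -/

lemma sum_kronecker_right {κ l m n p : Type*} (s : Finset κ) (X : κ → Matrix l m ℂ)
    (S : Matrix n p ℂ) : (∑ i ∈ s, X i) ⊗ₖ S = ∑ i ∈ s, X i ⊗ₖ S := by
  ext ⟨a, b⟩ ⟨c, d⟩
  simp [Matrix.sum_apply, Finset.sum_mul]

lemma kronecker_sum_left {κ l m n p : Type*} (s : Finset κ) (X : κ → Matrix l m ℂ)
    (S : Matrix n p ℂ) : S ⊗ₖ (∑ i ∈ s, X i) = ∑ i ∈ s, S ⊗ₖ X i := by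
  ext ⟨a, b⟩ ⟨c, d⟩
  simp [Matrix.sum_apply, Finset.mul_sum]

lemma ketbra_posSemidef {ι : Type*} [Fintype ι] (ψ : ι → ℂ) : (ketbra ψ).PosSemidef :=
  posSemidef_vecMulVec_self_star ψ

lemma bornProb_ketbra_ketbra {ι : Type*} [Fintype ι] (ψ φ : ι → ℂ) :
    bornProb (ketbra ψ) (ketbra φ) = Complex.normSq (star φ ⬝ᵥ ψ) := by
  have h : star ψ ⬝ᵥ φ = star (star φ ⬝ᵥ ψ) := by
    rw [star_dotProduct]
  rw [bornProb, ketbra, ketbra, vecMulVec_mul_vecMulVec, h, trace_vecMulVec, dotProduct_smul,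
    dotProduct_comm ψ, smul_eq_mul, Complex.star_def, ← Complex.normSq_eq_conj_mul_self]
  exact Complex.ofReal_re _

lemma bornProb_one {ι : Type*} [Fintype ι] [DecidableEq ι] (ψ : ι → ℂ) :
    bornProb (ketbra ψ) 1 = (star ψ ⬝ᵥ ψ).re := by
  rw [bornProb, mul_one, ketbra, trace_vecMulVec, dotProduct_comm]

open scoped MatrixOrder in
lemma bornProb_nonneg {ι : Type*} [Fintype ι] [DecidableEq ι] {ρ E : Matrix ι ι ℂ}
    (hρ : ρ.PosSemidef) (hE : E.PosSemidef) : 0 ≤ bornProb ρ E := by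
  obtain ⟨C, rfl⟩ := CStarAlgebra.nonneg_iff_eq_star_mul_self.mp hE.nonneg
  have h := (hρ.mul_mul_conjTranspose_same C).trace_nonneg
  rw [bornProb, star_eq_conjTranspose, ← Matrix.mul_assoc, Matrix.trace_mul_comm,
    ← Matrix.mul_assoc]
  exact (Complex.le_def.mp h).1

lemma trace_re_le_of_posSemidef_sub {ι : Type*} [Fintype ι] {Y R : Matrix ι ι ℂ}
    (h : (R - Y).PosSemidef) : Y.trace.re ≤ R.trace.re := by
  have := (Complex.le_def.mp h.trace_nonneg).1
  simpa [trace_sub] using this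

/-! ### Antidistinguishability and its dual -/

/-- A witness `Y` below every state of the family and of positive trace excludes
antidistinguishability. -/
lemma not_antidistinguishable_of_witness {I ι : Type*} [Fintype I] [Fintype ι] [DecidableEq ι]
    {ρ : I → Matrix ι ι ℂ} {Y : Matrix ι ι ℂ} (hY : ∀ i, (ρ i - Y).PosSemidef)
    (hpos : 0 < Y.trace.re) : ¬ Antidistinguishable ρ := by
  rintro ⟨M, ⟨hM, hsum⟩, h0, -⟩
  -- The effects sum to `1`, so pairing them all with the same `Y` yields `Tr Y`.
  have h1 : ∑ j, bornProb (ρ j - Y) (M j) = ∑ j, bornProb (ρ j) (M j) - Y.trace.re := by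
    have : Y.trace = ∑ j, (Y * M j).trace := by
      rw [← trace_sum, ← Finset.mul_sum, hsum, mul_one]
    simp [bornProb, this, sub_mul, trace_sub, Finset.sum_sub_distrib]
  have h2 : 0 ≤ ∑ j, bornProb (ρ j - Y) (M j) :=
    Finset.sum_nonneg fun j _ => bornProb_nonneg (hY j) (hM j)
  simp only [h0, Finset.sum_const_zero] at h1
  linarith

/-! ### Local instruments -/

section Instrument

variable {A B : Type} [Fintype A] [DecidableEq A] [Fintype B] [DecidableEq B]

/-- The completely positive map of the outcome `k` of an instrument. -/
def Instrument.apply (J : Instrument A) (k : Fin J.outcomes) (R : Matrix A A ℂ) :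
    Matrix (Fin (J.dim k)) (Fin (J.dim k)) ℂ :=
  ∑ l, J.K k l * R * (J.K k l)ᴴ

lemma Instrument.apply_posSemidef (J : Instrument A) (k : Fin J.outcomes) {R : Matrix A A ℂ}
    (hR : R.PosSemidef) : (J.apply k R).PosSemidef :=
  posSemidef_sum _ fun l _ => hR.mul_mul_conjTranspose_same (J.K k l)

lemma Instrument.apply_sub (J : Instrument A) (k : Fin J.outcomes) (R Y : Matrix A A ℂ) :
    J.apply k (R - Y) = J.apply k R - J.apply k Y := by
  simp [Instrument.apply, Matrix.mul_sub, Matrix.sub_mul]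

lemma Instrument.sum_trace_apply (J : Instrument A) (R : Matrix A A ℂ) :
    ∑ k, (J.apply k R).trace = R.trace := by
  have : ∀ k l, (J.K k l * R * (J.K k l)ᴴ).trace = (R * ((J.K k l)ᴴ * J.K k l)).trace := by
    intro k l
    rw [Matrix.mul_assoc, trace_mul_comm, Matrix.mul_assoc]
  simp only [Instrument.apply, trace_sum, this]
  simp only [← trace_sum, ← Matrix.mul_sum, J.complete, mul_one]

/-- A single branch may give the witness negative trace. Positive parts keep the products in the
LOCC bound monotone, and they are subadditive over branches. -/
lemma Instrument.max_trace_le_sum (J : Instrument A) (Y : Matrix A A ℂ) :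
    max Y.trace.re 0 ≤ ∑ k, max (J.apply k Y).trace.re 0 := by
  refine max_le ?_ (Finset.sum_nonneg fun k _ => le_max_right _ _)
  rw [← J.sum_trace_apply Y, Complex.re_sum]
  exact Finset.sum_le_sum fun k _ => le_max_left _ _

/-- Passage from the Heisenberg to the Schrödinger picture: a product input stays a product in every
branch, so induction on the protocol applies. -/
lemma bornProb_alice (J : Instrument A) (R : Matrix A A ℂ) (S : Matrix B B ℂ)
    (E : (k : Fin J.outcomes) → Matrix (Fin (J.dim k) × B) (Fin (J.dim k) × B) ℂ) :
    bornProb (R ⊗ₖ S) (∑ k, ∑ l, (J.K k l ⊗ₖ (1 : Matrix B B ℂ))ᴴ * E k *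
        (J.K k l ⊗ₖ (1 : Matrix B B ℂ))) = ∑ k, bornProb (J.apply k R ⊗ₖ S) (E k) := by
  simp only [bornProb, Instrument.apply, sum_kronecker_right, Matrix.mul_sum, Matrix.sum_mul,
    trace_sum, Complex.re_sum]
  refine Finset.sum_congr rfl fun k _ => Finset.sum_congr rfl fun l _ => ?_
  have : (J.K k l * R * (J.K k l)ᴴ) ⊗ₖ S =
      (J.K k l ⊗ₖ (1 : Matrix B B ℂ)) * (R ⊗ₖ S) * (J.K k l ⊗ₖ (1 : Matrix B B ℂ))ᴴ := by
    simp [conjTranspose_kronecker, ← mul_kronecker_mul]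
  rw [this, ← Matrix.mul_assoc, trace_mul_comm]
  simp only [Matrix.mul_assoc]

lemma bornProb_bob (J : Instrument B) (R : Matrix A A ℂ) (S : Matrix B B ℂ)
    (E : (k : Fin J.outcomes) → Matrix (A × Fin (J.dim k)) (A × Fin (J.dim k)) ℂ) :
    bornProb (R ⊗ₖ S) (∑ k, ∑ l, ((1 : Matrix A A ℂ) ⊗ₖ J.K k l)ᴴ * E k *
        ((1 : Matrix A A ℂ) ⊗ₖ J.K k l)) = ∑ k, bornProb (R ⊗ₖ J.apply k S) (E k) := by
  simp only [bornProb, Instrument.apply, kronecker_sum_left, Matrix.mul_sum, Matrix.sum_mul,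
    trace_sum, Complex.re_sum]
  refine Finset.sum_congr rfl fun k _ => Finset.sum_congr rfl fun l _ => ?_
  have : R ⊗ₖ (J.K k l * S * (J.K k l)ᴴ) =
      ((1 : Matrix A A ℂ) ⊗ₖ J.K k l) * (R ⊗ₖ S) * ((1 : Matrix A A ℂ) ⊗ₖ J.K k l)ᴴ := by
    simp [conjTranspose_kronecker, ← mul_kronecker_mul]
  rw [this, ← Matrix.mul_assoc, trace_mul_comm]
  simp only [Matrix.mul_assoc]

end Instrument

/-! ### A lower bound on the error of LOCC protocols -/

/-- If `Y` lies below every `R o` and `Z` below every `S o`, then the probability that an LOCC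
protocol announces a label `o` on the (unnormalised) state `R o ⊗ S o`, summed over `o`, is at
least the product of the positive parts of the traces of `Y` and `Z`. -/
theorem Protocol.mul_trace_le_sum_bornProb {O : Type} [Fintype O] [DecidableEq O] {A B : Type}
    [Fintype A] [DecidableEq A] [Fintype B] [DecidableEq B] (P : Protocol O A B)
    {Y : Matrix A A ℂ} {Z : Matrix B B ℂ} {R : O → Matrix A A ℂ} {S : O → Matrix B B ℂ}
    (hR : ∀ o, (R o).PosSemidef) (hS : ∀ o, (S o).PosSemidef)
    (hY : ∀ o, (R o - Y).PosSemidef) (hZ : ∀ o, (S o - Z).PosSemidef) :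
    max Y.trace.re 0 * max Z.trace.re 0 ≤ ∑ o, bornProb (R o ⊗ₖ S o) (P.povm o) := by
  induction P with
  | announce o =>
    have hR0 := Complex.le_def.mp (hR o).trace_nonneg
    have hS0 := Complex.le_def.mp (hS o).trace_nonneg
    have h : ∑ o', bornProb (R o' ⊗ₖ S o')
        ((Protocol.announce o : Protocol O _ _).povm o') = (R o).trace.re * (S o).trace.re := by
      rw [Finset.sum_eq_single o]
      · simp [Protocol.povm, bornProb, trace_kronecker, ← hR0.2]
      · intro b _ hb
        simp [Protocol.povm, bornProb, hb]
      · simp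
    rw [h]
    -- Only the announced label contributes, and its two traces dominate the positive parts
    -- separately; `Y ⊗ Z ≤ R o ⊗ S o` is never needed.
    exact mul_le_mul (max_le (trace_re_le_of_posSemidef_sub (hY o)) hR0.1)
      (max_le (trace_re_le_of_posSemidef_sub (hZ o)) hS0.1) (le_max_right _ _) hR0.1
  | alice J next ih =>
    simp only [Protocol.povm, bornProb_alice]
    rw [Finset.sum_comm]
    refine (mul_le_mul_of_nonneg_right (J.max_trace_le_sum Y) (le_max_right _ _)).trans ?_
    rw [Finset.sum_mul]
    exact Finset.sum_le_sum fun k _ => ih k (fun o => J.apply_posSemidef k (hR o)) hS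
      (fun o => J.apply_sub k (R o) Y ▸ J.apply_posSemidef k (hY o)) hZ
  | bob J next ih =>
    simp only [Protocol.povm, bornProb_bob]
    rw [Finset.sum_comm]
    refine (mul_le_mul_of_nonneg_left (J.max_trace_le_sum Z) (le_max_right _ _)).trans ?_
    rw [Finset.mul_sum]
    exact Finset.sum_le_sum fun k _ => ih k hR (fun o => J.apply_posSemidef k (hS o)) hY
      (fun o => J.apply_sub k (S o) Z ▸ J.apply_posSemidef k (hZ o))

/-! ### Antimarking of product states -/

section ProductStates

lemma ketbra_productState {A B : Type} (α : A → ℂ) (β : B → ℂ) :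
    ketbra (productState α β) = ketbra α ⊗ₖ ketbra β := by
  ext ⟨a, b⟩ ⟨c, d⟩
  simp [ketbra, productState, vecMulVec_apply]
  ring

/-- The state `a (s 1) ⊗ ⋯ ⊗ a (s n)` of one party. -/
def localSeqState {I A : Type} (a : I → A → ℂ) {n : ℕ} (s : Fin n ↪ I) : (Fin n → A) → ℂ :=
  fun x => ∏ t, a (s t) (x t)

lemma seqState_productState {I A B : Type} (a : I → A → ℂ) (b : I → B → ℂ) {n : ℕ} (s : Fin n ↪ I) :
    seqState (fun i => productState (a i) (b i)) s =
      productState (localSeqState a s) (localSeqState b s) := by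
  funext x
  simp [seqState, productState, localSeqState, Finset.prod_mul_distrib]

variable {I A B : Type} [Fintype A] [DecidableEq A] [Fintype B] [DecidableEq B]

/-- A family of product states is not antimarkable by limits of LOCC protocols if, for each
party, some matrix of positive trace lies below all local sequence states. -/
theorem not_asymptoticallyLOCCAntimarkable_of_witness [Fintype I] [DecidableEq I]
    {a : I → A → ℂ} {b : I → B → ℂ} {n m : ℕ}
    (hm : 0 < m) {Y : Matrix (Fin n → A) (Fin n → A) ℂ} {Z : Matrix (Fin n → B) (Fin n → B) ℂ}
    (hY : ∀ s : Fin n ↪ I, (ketbra (localSeqState a s) - Y).PosSemidef)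
    (hZ : ∀ s : Fin n ↪ I, (ketbra (localSeqState b s) - Z).PosSemidef)
    (hYpos : 0 < Y.trace.re) (hZpos : 0 < Z.trace.re) :
    ¬ AsymptoticallyLOCCAntimarkable (fun i => productState (a i) (b i)) n m := by
  rintro ⟨M, hM, helim⟩
  have hne : ∀ T : Answer I n m, ∃ s, s ∈ T.1 := fun T =>
    Finset.card_pos.mp (T.2.symm ▸ hm)
  choose σ hσ using hne
  let R : Answer I n m → Matrix (Fin n → A) (Fin n → A) ℂ :=
    fun T => ketbra (localSeqState a (σ T))
  let S : Answer I n m → Matrix (Fin n → B) (Fin n → B) ℂ :=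
    fun T => ketbra (localSeqState b (σ T))
  -- One announced sequence `σ T` per answer already gives a positive lower bound on the error; this
  -- is a closed condition on the POVM.
  have hclosed : IsClosed {N : Answer I n m → Matrix ((Fin n → A) × (Fin n → B))
      ((Fin n → A) × (Fin n → B)) ℂ |
      Y.trace.re * Z.trace.re ≤ ∑ T, bornProb (R T ⊗ₖ S T) (N T)} := by
    refine isClosed_le continuous_const (continuous_finsetSum _ fun T _ => ?_)
    exact Complex.continuous_re.comp
      (continuous_const.matrix_mul (continuous_apply T)).matrix_trace
  have hle := closure_minimal (Set.range_subset_iff.mpr fun P => ?_) hclosed hM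
  · have h0 : ∀ T, bornProb (R T ⊗ₖ S T) (M T) = 0 := by
      intro T
      have := helim T (σ T) (hσ T)
      rwa [seqState_productState, ketbra_productState] at this
    simp only [Set.mem_ofPred_eq, h0, Finset.sum_const_zero] at hle
    exact absurd hle (not_le.mpr (mul_pos hYpos hZpos))
  · have h := P.mul_trace_le_sum_bornProb (R := R) (S := S) (fun T => ketbra_posSemidef _)
      (fun T => ketbra_posSemidef _) (fun T => hY (σ T)) (fun T => hZ (σ T))
    rwa [max_eq_left hYpos.le, max_eq_left hZpos.le] at h

lemma LOCCAntimarkable.asymptotically [DecidableEq I] {ψ : I → A × B → ℂ} {n m : ℕ}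
    (h : LOCCAntimarkable ψ n m) : AsymptoticallyLOCCAntimarkable ψ n m := by
  obtain ⟨P, hP⟩ := h
  exact ⟨P.povm, subset_closure ⟨P, rfl⟩, hP⟩

/-- Antidistinguishing the sequence states solves the `(n, 1)`-antimarking task. -/
lemma globallyAntimarkable_one_of_antidistinguishable [Fintype I] {ψ : I → A × B → ℂ} {n : ℕ}
    (h : Antidistinguishable (fun s : Fin n ↪ I => ketbra (seqState ψ s))) :
    GloballyAntimarkable ψ n 1 := by
  obtain ⟨M, ⟨hM, hsum⟩, h0, -⟩ := h
  -- Each `T` is a singleton, so the sum merely reads off its element.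
  refine ⟨fun T => ∑ s ∈ T.1, M s, ⟨fun T => posSemidef_sum _ fun s _ => hM s, ?_⟩, ?_⟩
  · rw [← hsum]
    symm
    refine Fintype.sum_bijective
      (fun s : Fin n ↪ I => (⟨{s}, Finset.card_singleton s⟩ : Answer I n 1)) ⟨?_, ?_⟩ _ _ ?_
    · intro s t hst
      simpa using hst
    · rintro ⟨T, hT⟩
      obtain ⟨s, rfl⟩ := Finset.card_eq_one.mp hT
      exact ⟨s, rfl⟩
    · simp
  · rintro ⟨T, hT⟩ s hs
    obtain ⟨t, rfl⟩ := Finset.card_eq_one.mp hT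
    obtain rfl := Finset.mem_singleton.mp hs
    simpa using h0 s

end ProductStates

/-! ### The witness for `|00⟩`, `|0+⟩`, `|+0⟩` -/

/-- A matrix of positive trace below the projectors onto `|00⟩`, `|0+⟩` and `|+0⟩`. -/
def pairWitness : Matrix (Fin 2 × Fin 2) (Fin 2 × Fin 2) ℂ :=
  ketbra (productState ket0 ket0) - ((1 / 15 : ℝ) • ketbra (fun x => !![-1, -1/2; 1, 0] x.1 x.2) +
    (1 / 20 : ℝ) • ketbra (fun x => !![-2, 1; 0, 0] x.1 x.2) +
    (89 / 150 : ℝ) • ketbra (fun x => !![1, 0; 0, 0] x.1 x.2))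

lemma trace_pairWitness : pairWitness.trace = 1 / 150 := by
  simp [pairWitness, trace, Fintype.sum_prod_type, ketbra, vecMulVec_apply, productState, ket0,
    Complex.conj_ofNat]
  norm_num

lemma inv_sqrt_two_mul_self : ((√2 : ℝ) : ℂ)⁻¹ * ((√2 : ℝ) : ℂ)⁻¹ = 1 / 2 := by
  rw [← mul_inv, ← Complex.ofReal_mul, Real.mul_self_sqrt (by norm_num)]
  norm_num

lemma ket00_sub_pairWitness : (ketbra (productState ket0 ket0) - pairWitness).PosSemidef := by
  rw [pairWitness, sub_sub_cancel]
  exact (((ketbra_posSemidef _).smul (by norm_num)).add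
    ((ketbra_posSemidef _).smul (by norm_num))).add ((ketbra_posSemidef _).smul (by norm_num))

lemma ket0Plus_sub_pairWitness :
    (ketbra (productState ket0 ketPlus) - pairWitness).PosSemidef := by
  -- Completing squares in the coordinates `10`, `01`, `00`, in this order; the row and column of
  -- `11` vanish.
  have h : ketbra (productState ket0 ketPlus) - pairWitness =
      (1 / 15 : ℝ) • ketbra (fun x => !![-1, -1/2; 1, 0] x.1 x.2) +
      (11 / 20 : ℝ) • ketbra (fun x => !![8/11, 1; 0, 0] x.1 x.2) +
      (2 / 825 : ℝ) • ketbra (fun x => !![1, 0; 0, 0] x.1 x.2) := by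
    ext ⟨a, b⟩ ⟨c, d⟩
    fin_cases a <;> fin_cases b <;> fin_cases c <;> fin_cases d <;>
      simp [pairWitness, ketbra, vecMulVec_apply, productState, ket0, ketPlus,
        inv_sqrt_two_mul_self] <;> norm_num
  rw [h]
  exact (((ketbra_posSemidef _).smul (by norm_num)).add
    ((ketbra_posSemidef _).smul (by norm_num))).add ((ketbra_posSemidef _).smul (by norm_num))

lemma ketPlus0_sub_pairWitness :
    (ketbra (productState ketPlus ket0) - pairWitness).PosSemidef := by
  have h : ketbra (productState ketPlus ket0) - pairWitness =
      (1 / 15 : ℝ) • ketbra (fun x => !![-1, 1; -1/2, 0] x.1 x.2) +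
      (11 / 20 : ℝ) • ketbra (fun x => !![8/11, 0; 1, 0] x.1 x.2) +
      (2 / 825 : ℝ) • ketbra (fun x => !![1, 0; 0, 0] x.1 x.2) := by
    ext ⟨a, b⟩ ⟨c, d⟩
    fin_cases a <;> fin_cases b <;> fin_cases c <;> fin_cases d <;>
      simp [pairWitness, ketbra, vecMulVec_apply, productState, ket0, ketPlus,
        inv_sqrt_two_mul_self] <;> norm_num
  rw [h]
  exact (((ketbra_posSemidef _).smul (by norm_num)).add
    ((ketbra_posSemidef _).smul (by norm_num))).add ((ketbra_posSemidef _).smul (by norm_num))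

theorem not_antidistinguishable_SU : ¬ Antidistinguishable (fun i : Fin 3 => ketbra (SU i)) := by
  refine not_antidistinguishable_of_witness (Y := pairWitness) (fun i => ?_) ?_
  · fin_cases i
    exacts [ket00_sub_pairWitness, ket0Plus_sub_pairWitness, ketPlus0_sub_pairWitness]
  · rw [trace_pairWitness]
    norm_num

/-! ### LOCC protocols do not antimark -/

lemma localSeqState_two {I : Type} (a : I → Fin 2 → ℂ) (s : Fin 2 ↪ I) :
    localSeqState a s = productState (a (s 0)) (a (s 1)) ∘ finTwoArrowEquiv (Fin 2) := by
  funext x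
  simp [localSeqState, productState]

/-- An injective pair contains `j` at most once, which rules out `|++⟩`, the only product not
covered by the witness. -/
lemma ketbra_localSeqState_sub_posSemidef {a : Fin 3 → Fin 2 → ℂ} (j : Fin 3)
    (hj : a j = ketPlus) (hne : ∀ i, i ≠ j → a i = ket0) (s : Fin 2 ↪ Fin 3) :
    (ketbra (localSeqState a s) - pairWitness.submatrix (finTwoArrowEquiv (Fin 2))
      (finTwoArrowEquiv (Fin 2))).PosSemidef := by
  have hs : s 0 ≠ s 1 := fun h => by simpa using s.injective h
  have key : (ketbra (productState (a (s 0)) (a (s 1))) - pairWitness).PosSemidef := by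
    by_cases h0 : s 0 = j
    · rw [h0, hj, hne _ (h0 ▸ hs.symm)]
      exact ketPlus0_sub_pairWitness
    · by_cases h1 : s 1 = j
      · rw [h1, hj, hne _ h0]
        exact ket0Plus_sub_pairWitness
      · rw [hne _ h0, hne _ h1]
        exact ket00_sub_pairWitness
  rw [localSeqState_two]
  exact key.submatrix (finTwoArrowEquiv (Fin 2))

lemma SU_eq_productState :
    SU = fun i => productState (![ket0, ket0, ketPlus] i) (![ket0, ketPlus, ket0] i) := by
  funext i
  fin_cases i <;> rfl

theorem not_asymptoticallyLOCCAntimarkable_SU : ¬ AsymptoticallyLOCCAntimarkable SU 2 1 := by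
  have htr : 0 < (pairWitness.submatrix (finTwoArrowEquiv (Fin 2))
      (finTwoArrowEquiv (Fin 2))).trace.re := by
    have : (pairWitness.submatrix (finTwoArrowEquiv (Fin 2))
        (finTwoArrowEquiv (Fin 2))).trace = pairWitness.trace :=
      (finTwoArrowEquiv (Fin 2)).sum_comp fun x => pairWitness x x
    rw [this, trace_pairWitness]
    norm_num
  rw [SU_eq_productState]
  refine not_asymptoticallyLOCCAntimarkable_of_witness one_pos
    (ketbra_localSeqState_sub_posSemidef 2 rfl ?_) (ketbra_localSeqState_sub_posSemidef 1 rfl ?_)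
    htr htr
  · intro i hi
    fin_cases i <;> simp_all
  · intro i hi
    fin_cases i <;> simp_all

/-! ### The global measurement -/

lemma ketbra_mul_ketbra {ι : Type*} [Fintype ι] (φ χ : ι → ℂ) :
    ketbra φ * ketbra χ = (star φ ⬝ᵥ χ) • vecMulVec φ (star χ) := by
  rw [ketbra, ketbra, vecMulVec_mul_vecMulVec, vecMulVec_smul]

/-- The projector onto the orthogonal complement of two orthonormal vectors. -/
lemma one_sub_ketbra_sub_ketbra_posSemidef {ι : Type*} [Fintype ι] [DecidableEq ι]
    {φ χ : ι → ℂ} (hφ : star φ ⬝ᵥ φ = 1) (hχ : star χ ⬝ᵥ χ = 1) (h : star φ ⬝ᵥ χ = 0) :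
    (1 - ketbra φ - ketbra χ).PosSemidef := by
  have h' : star χ ⬝ᵥ φ = 0 := by rw [star_dotProduct, h, star_zero]
  have hP : (1 - ketbra φ - ketbra χ)ᴴ = 1 - ketbra φ - ketbra χ := by
    simp [(ketbra_posSemidef φ).isHermitian.eq, (ketbra_posSemidef χ).isHermitian.eq]
  have hφφ : ketbra φ * ketbra φ = ketbra φ := by
    rw [ketbra_mul_ketbra, hφ, one_smul, ketbra]
  have hχχ : ketbra χ * ketbra χ = ketbra χ := by
    rw [ketbra_mul_ketbra, hχ, one_smul, ketbra]
  have hφχ : ketbra φ * ketbra χ = 0 := by rw [ketbra_mul_ketbra, h, zero_smul]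
  have hχφ : ketbra χ * ketbra φ = 0 := by rw [ketbra_mul_ketbra, h', zero_smul]
  have hsq : (1 - ketbra φ - ketbra χ)ᴴ * (1 - ketbra φ - ketbra χ) =
      1 - ketbra φ - ketbra χ := by
    rw [hP]
    simp [sub_mul, mul_sub, hφφ, hχχ, hφχ, hχφ]
  rw [← hsq]
  exact posSemidef_conjTranspose_mul_self _

/-- The vector `(|x⟩ + |y⟩ + |z⟩ - |w⟩) / 2`. -/
def hadamardVec {ι : Type*} [DecidableEq ι] (x y z w : ι) : ι → ℂ :=
  (1 / 2 : ℂ) • (Pi.single x 1 + Pi.single y 1 + Pi.single z 1 - Pi.single w 1)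

lemma star_hadamardVec_dotProduct {ι : Type*} [Fintype ι] [DecidableEq ι] (x y z w : ι)
    (ψ : ι → ℂ) :
    star (hadamardVec x y z w) ⬝ᵥ ψ = (ψ x + ψ y + ψ z - ψ w) / 2 := by
  have hs : star (hadamardVec x y z w) = hadamardVec x y z w := by
    funext t
    simp only [hadamardVec, Pi.star_apply, Pi.smul_apply, Pi.add_apply, Pi.sub_apply,
      Pi.single_apply]
    split_ifs <;> simp
  rw [hs, hadamardVec, smul_dotProduct, sub_dotProduct, add_dotProduct, add_dotProduct]
  simp only [single_one_dotProduct, smul_eq_mul]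
  ring

/-- The basis of `A₁A₂B₁B₂`. -/
abbrev QuadIndex : Type := (Fin 2 → Fin 2) × (Fin 2 → Fin 2)

/-- The basis state `|0000⟩` of `A₁A₂B₁B₂`. -/
def zeroIndex : QuadIndex := (![0, 0], ![0, 0])

/-- The basis state with the qubit `A_t` excited. -/
def excitedA (t : Fin 2) : QuadIndex := (Pi.single t 1, ![0, 0])

/-- The basis state with the qubit `B_t` excited. -/
def excitedB (t : Fin 2) : QuadIndex := (![0, 0], Pi.single t 1)

/-- The vectors `(|0000⟩ + |B_t⟩ + |A_r⟩ - |A_{1-r}⟩) / 2`. -/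
def elimVec (t r : Fin 2) : QuadIndex → ℂ :=
  hadamardVec zeroIndex (excitedB t) (excitedA r) (excitedA (1 - r))

/-- Twice the effects of the antidistinguishing measurement, indexed by the announced pair. -/
def pairEffect : Fin 3 → Fin 3 → Matrix QuadIndex QuadIndex ℂ :=
  ![![0, 1 - ketbra (elimVec 1 0) - ketbra (elimVec 1 1), ketbra (elimVec 0 0)],
    ![1 - ketbra (elimVec 0 0) - ketbra (elimVec 0 1), 0, ketbra (elimVec 1 0)],
    ![ketbra (elimVec 1 1), ketbra (elimVec 0 1), 0]]

/-- The state `ψ_i ⊗ ψ_j`. -/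
def pairState (i j : Fin 3) : QuadIndex → ℂ :=
  fun x => SU i (x.1 0, x.2 0) * SU j (x.1 1, x.2 1)

lemma seqState_SU_two (s : Fin 2 ↪ Fin 3) : seqState SU s = pairState (s 0) (s 1) := by
  funext x
  simp [seqState, pairState]

lemma elimVec_dotProduct (t r : Fin 2) (ψ : QuadIndex → ℂ) :
    star (elimVec t r) ⬝ᵥ ψ =
      (ψ zeroIndex + ψ (excitedB t) + ψ (excitedA r) - ψ (excitedA (1 - r))) / 2 :=
  star_hadamardVec_dotProduct _ _ _ _ _

lemma elimVec_orthonormal (t r r' : Fin 2) :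
    star (elimVec t r) ⬝ᵥ elimVec t r' = if r = r' then 1 else 0 := by
  rw [elimVec_dotProduct]
  have h1 : ∀ a b : Fin 2, excitedA a = excitedA b ↔ a = b := by decide
  have h3 : ∀ a b : Fin 2, excitedA a ≠ excitedB b := by decide
  have h4 : ∀ a : Fin 2, excitedA a ≠ zeroIndex := by decide
  have h5 : ∀ a : Fin 2, excitedB a ≠ zeroIndex := by decide
  fin_cases r <;> fin_cases r' <;>
    simp [elimVec, hadamardVec, h1, h3, h4, h5, (h3 _ _).symm,
      (h4 _).symm, (h5 _).symm] <;> norm_num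

lemma pairEffect_posSemidef (i j : Fin 3) : (pairEffect i j).PosSemidef := by
  have h : ∀ t, (1 - ketbra (elimVec t 0) - ketbra (elimVec t 1)).PosSemidef := fun t =>
    one_sub_ketbra_sub_ketbra_posSemidef (by simp [elimVec_orthonormal])
      (by simp [elimVec_orthonormal]) (by simp [elimVec_orthonormal])
  fin_cases i <;> fin_cases j <;>
    first
    | exact PosSemidef.zero
    | exact h _
    | exact ketbra_posSemidef _

/-- Each of the four rank-one projectors occurs once with each sign, leaving the two identities. -/
lemma sum_pairEffect : ∑ i, ∑ j, pairEffect i j = (2 : ℝ) • 1 := by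
  simp only [Fin.sum_univ_three, pairEffect, cons_val_zero, cons_val_one, cons_val, two_smul]
  abel

/-- The sequence `i, j`. -/
def pairEmbedding {I : Type*} {i j : I} (h : i ≠ j) : Fin 2 ↪ I where
  toFun := ![i, j]
  inj' := by
    rw [← List.nodup_ofFn]
    simpa using h

lemma sum_embedding_fin_two {I M : Type*} [Fintype I] [DecidableEq I] [AddCommMonoid M]
    (f : I → I → M) (hf : ∀ i, f i i = 0) :
    ∑ s : Fin 2 ↪ I, f (s 0) (s 1) = ∑ i, ∑ j, f i j := by
  rw [← Fintype.sum_prod_type' f]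
  refine Finset.sum_of_injOn (fun s => (s 0, s 1)) ?_ (by simp) ?_ (by simp)
  · intro s _ t _ h
    ext a
    have h := Prod.ext_iff.mp h
    fin_cases a
    exacts [h.1, h.2]
  · rintro ⟨i, j⟩ - hij
    by_cases h : i = j
    · subst h
      exact hf i
    · exact absurd ⟨pairEmbedding h, Finset.mem_coe.mpr (Finset.mem_univ _), rfl⟩ hij

lemma star_pairState_dotProduct_self (i j : Fin 3) :
    star (pairState i j) ⬝ᵥ pairState i j = 1 := by
  have hSU : ∀ i, ∑ x, star (SU i x) * SU i x = 1 := by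
    intro i
    fin_cases i <;> simp [SU, Fintype.sum_prod_type, productState, ket0, ketPlus,
      inv_sqrt_two_mul_self] <;> norm_num
  -- Regroups `A₁A₂|B₁B₂` as `A₁B₁|A₂B₂`, where the norm factorises.
  let e : QuadIndex ≃ (Fin 2 × Fin 2) × (Fin 2 × Fin 2) :=
    ((finTwoArrowEquiv _).prodCongr (finTwoArrowEquiv _)).trans (Equiv.prodProdProdComm ..)
  calc star (pairState i j) ⬝ᵥ pairState i j
      = ∑ x, (fun y : (Fin 2 × Fin 2) × (Fin 2 × Fin 2) =>
          (star (SU i y.1) * SU i y.1) * (star (SU j y.2) * SU j y.2)) (e x) := by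
        refine Finset.sum_congr rfl fun x _ => ?_
        simp [pairState, e]
        ring
    _ = 1 := by
        rw [e.sum_comp (fun y : (Fin 2 × Fin 2) × (Fin 2 × Fin 2) =>
          (star (SU i y.1) * SU i y.1) * (star (SU j y.2) * SU j y.2)), Fintype.sum_prod_type]
        simp only [← Finset.mul_sum, hSU, mul_one]

lemma bornProb_sub_right {ι : Type*} [Fintype ι] (ρ E F : Matrix ι ι ℂ) :
    bornProb ρ (E - F) = bornProb ρ E - bornProb ρ F := by
  simp [bornProb, mul_sub, trace_sub]

/-- Without `ψ_3` the state is `(|0000⟩ + |B_t⟩) / √2`, the normalised sum of `elimVec t 0` and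
`elimVec t 1`, so the complementary projector kills it. With `ψ_3`, the equal amplitudes at `|0000⟩`
and `|A_{1-r}⟩` cancel in the overlap with `elimVec t r`, since those at `|B_t⟩` and `|A_r⟩` vanish.
-/
lemma bornProb_pairEffect_self {i j : Fin 3} (h : i ≠ j) :
    bornProb (ketbra (pairState i j)) (pairEffect i j) = 0 := by
  fin_cases i <;> fin_cases j <;> first | exact absurd rfl h | skip
  all_goals
    simp [pairEffect, bornProb_sub_right, bornProb_ketbra_ketbra, bornProb_one,
      star_pairState_dotProduct_self, elimVec_dotProduct, pairState, SU, productState, ket0,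
      ketPlus, zeroIndex, excitedA, excitedB] <;> norm_num

lemma exists_bornProb_pairEffect_pos {i j : Fin 3} (h : i ≠ j) :
    ∃ k l, k ≠ l ∧ 0 < bornProb (ketbra (pairState k l)) (pairEffect i j) := by
  fin_cases i <;> fin_cases j <;> first | exact absurd rfl h | skip
  -- A rank-one effect from `elimVec t r` is tested on `(|0000⟩ + |B_t⟩) / √2`, with overlap `1/√2`;
  -- a complementary projector on a state with a component outside the removed plane.
  on_goal 1 => refine ⟨1, 2, by decide, ?_⟩
  on_goal 2 => refine ⟨1, 0, by decide, ?_⟩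
  on_goal 3 => refine ⟨2, 1, by decide, ?_⟩
  on_goal 4 => refine ⟨0, 1, by decide, ?_⟩
  on_goal 5 => refine ⟨0, 1, by decide, ?_⟩
  on_goal 6 => refine ⟨1, 0, by decide, ?_⟩
  all_goals
    simp [pairEffect, bornProb_sub_right, bornProb_ketbra_ketbra, bornProb_one,
      star_pairState_dotProduct_self, elimVec_dotProduct, pairState, SU, productState, ket0,
      ketPlus, zeroIndex, excitedA, excitedB] <;> norm_num

theorem antidistinguishable_seqState_SU :
    Antidistinguishable (fun s : Fin 2 ↪ Fin 3 => ketbra (seqState SU s)) := by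
  have hne : ∀ s : Fin 2 ↪ Fin 3, s 0 ≠ s 1 := fun s h => by simpa using s.injective h
  have hsmul : ∀ (ρ E : Matrix QuadIndex QuadIndex ℂ),
      bornProb ρ ((1 / 2 : ℝ) • E) = 1 / 2 * bornProb ρ E := by
    intro ρ E
    simp [bornProb, trace_smul]
  refine ⟨fun s => (1 / 2 : ℝ) • pairEffect (s 0) (s 1), ⟨fun s => ?_, ?_⟩, fun s => ?_,
    fun s => ?_⟩
  · exact (pairEffect_posSemidef _ _).smul (by norm_num)
  · rw [← Finset.smul_sum, sum_embedding_fin_two pairEffect fun i => by fin_cases i <;> rfl,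
      sum_pairEffect, smul_smul]
    norm_num
  · change bornProb (ketbra (seqState SU s)) _ = 0
    rw [hsmul, seqState_SU_two, bornProb_pairEffect_self (hne s), mul_zero]
  · obtain ⟨k, l, hkl, hpos⟩ := exists_bornProb_pairEffect_pos (hne s)
    refine Finset.sum_pos' (fun t _ => ?_) ⟨pairEmbedding hkl, Finset.mem_univ _, ?_⟩
    · exact bornProb_nonneg (ketbra_posSemidef _)
        ((pairEffect_posSemidef _ _).smul (by norm_num))
    · change 0 < bornProb (ketbra (seqState SU (pairEmbedding hkl))) _
      rw [hsmul, seqState_SU_two]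
      exact mul_pos (by norm_num) hpos

end Antimarking

end

theorem mainTheorem1 :
    (¬ Antimarking.Antidistinguishable
        (fun i : Fin 3 => Antimarking.ketbra (Antimarking.SU i))) ∧
    Antimarking.Antidistinguishable
        (fun s : Fin 2 ↪ Fin 3 => Antimarking.ketbra (Antimarking.seqState Antimarking.SU s)) ∧
    Antimarking.GloballyAntimarkable Antimarking.SU 2 1 ∧
    (¬ Antimarking.LOCCAntimarkable Antimarking.SU 2 1) ∧
    (¬ Antimarking.AsymptoticallyLOCCAntimarkable Antimarking.SU 2 1) :=
  ⟨Antimarking.not_antidistinguishable_SU, Antimarking.antidistinguishable_seqState_SU,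
    Antimarking.globallyAntimarkable_one_of_antidistinguishable
      Antimarking.antidistinguishable_seqState_SU,
    fun h => Antimarking.not_asymptoticallyLOCCAntimarkable_SU h.asymptotically,
    Antimarking.not_asymptoticallyLOCCAntimarkable_SU⟩
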